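/- Let $n\in\mathbb N$, let $\Omega\subset\mathbb R^n$ be open and connected, let $F\in C^1(\Omega,\mathbb R^n)$, and let $\phi(t,z)$ be the local flow of $\dot z=F(z)$ in $\Omega$: $\phi(t,z)$ is the value at time $t$ of the solution in $\Omega$ that starts at $z$ at time $0$, for all $t$ (positive or negative) up to which this solution exists. Put $\Delta_0=\{z\in\Omega:\operatorname{div}F(z)=0\}$. Let $\sigma:\Omega\to\Omega$ be a $C^1$ map such that - $\sigma(\sigma(z))=z$ for all $z\in\Omega$ ($\sigma$ is an involution); - $\phi(t,\sigma(z))=\sigma(\phi(-t,z))$ for all $t\in\mathbb R$ and $z\in\Omega$ such that both sides are defined ($\sigma$ is a reversibility of $\dot z=F(z)$); - $\mu(\sigma(A))=\mu(A)$ for every measurable set $A\subset\Omega$, where $\mu$ is the Lebesgue measure ($\sigma$ is measure-preserving). Then: (i) if $z\in\Omega$ and $t_z\in\mathbb R$ are such that $\phi(t_z,z)$ is defined and $\sigma(z)=\phi(t_z,z)\neq z$, then the arc of orbit $\{\phi(s,z): s \text{ between } 0 \text{ and } t_z\}$ connecting $z$ to $\sigma(z)$ contains a point of $\Delta_0$;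 (ii) if $z\in\Omega$ satisfies $\sigma(z)=z$ and $F(z)\neq 0$, then $z\in\Delta_0$. -/

import Mathlib

open Set MeasureTheory

section Flow

variable {E : Type*} [NormedAddCommGroup E] [NormedSpace ℝ E]

/-- `γ` is a solution of `ż = F z` with `γ 0 = z`, staying in `Ω`, on the closed interval with
end points `0` and `t` (`t` may be negative; one-sided derivatives at the end points). -/
structure IsSolutionFrom (F : E → E) (Ω : Set E) (z : E) (t : ℝ) (γ : ℝ → E) : Prop where
  initial : γ 0 = z
  mapsTo : MapsTo γ (uIcc 0 t) Ω
  isIntegralCurveOn : IsIntegralCurveOn γ (fun _ => F) (uIcc 0 t)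

/-- The domain of the local flow of `ż = F z` in `Ω`: all `(t, z)` such that the solution starting
at `z` exists in `Ω` up to time `t`. -/
def flowDomain (F : E → E) (Ω : Set E) : Set (ℝ × E) :=
  {p | ∃ γ : ℝ → E, IsSolutionFrom F Ω p.2 p.1 γ}

open Classical in
/-- The local flow `φ(t, z)` of `ż = F z` in `Ω`: the value at time `t` of the solution starting at
`z` if `(t, z)` is in `flowDomain F Ω` (and, by convention, `z` otherwise). -/
noncomputable def localFlow (F : E → E) (Ω : Set E) (t : ℝ) (z : E) : E :=
  if h : ∃ γ : ℝ → E, IsSolutionFrom F Ω z t γ then h.choose t else z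

lemma IsSolutionFrom.neg {F : E → E} {Ω : Set E} {z : E} {t : ℝ} {γ : ℝ → E}
    (h : IsSolutionFrom F Ω z t γ) : IsSolutionFrom (-F) Ω z (-t) (fun s => γ (-s)) := by
  have hm : MapsTo (fun s : ℝ => -s) (uIcc 0 (-t)) (uIcc 0 t) := by
    intro s hs
    rw [mem_uIcc] at hs ⊢
    rcases hs with hs | hs
    · right; constructor <;> linarith [hs.1, hs.2]
    · left; constructor <;> linarith [hs.1, hs.2]
  refine ⟨by simpa using h.initial, fun s hs => h.mapsTo (hm hs), fun s hs => ?_⟩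
  have := (h.isIntegralCurveOn (-s) (hm hs)).scomp s (hasDerivAt_neg s).hasDerivWithinAt hm
  simpa [Function.comp_def] using this

/-- Solutions of a `C¹` system are unique. -/
theorem IsSolutionFrom.eq {F : E → E} {Ω : Set E} (hΩ : IsOpen Ω) (hF : ContDiffOn ℝ 1 F Ω)
    {z : E} {t : ℝ} {γ₁ γ₂ : ℝ → E} (h₁ : IsSolutionFrom F Ω z t γ₁)
    (h₂ : IsSolutionFrom F Ω z t γ₂) : γ₁ t = γ₂ t := by
  wlog ht : 0 ≤ t generalizing F t γ₁ γ₂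
  · simpa using this hF.neg h₁.neg h₂.neg (by linarith)
  have hI : uIcc 0 t = Icc 0 t := uIcc_of_le ht
  have hc₁ : ContinuousOn γ₁ (Icc 0 t) := hI ▸ h₁.isIntegralCurveOn.continuousOn
  have hc₂ : ContinuousOn γ₂ (Icc 0 t) := hI ▸ h₂.isIntegralCurveOn.continuousOn
  have hm₁ : MapsTo γ₁ (Icc 0 t) Ω := hI ▸ h₁.mapsTo
  have hm₂ : MapsTo γ₂ (Icc 0 t) Ω := hI ▸ h₂.mapsTo
  have hi₁ : IsIntegralCurveOn γ₁ (fun _ => F) (Icc 0 t) := hI ▸ h₁.isIntegralCurveOn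
  have hi₂ : IsIntegralCurveOn γ₂ (fun _ => F) (Icc 0 t) := hI ▸ h₂.isIntegralCurveOn
  have hK : IsCompact (γ₁ '' Icc 0 t ∪ γ₂ '' Icc 0 t) :=
    (isCompact_Icc.image_of_continuousOn hc₁).union (isCompact_Icc.image_of_continuousOn hc₂)
  have hKΩ : γ₁ '' Icc 0 t ∪ γ₂ '' Icc 0 t ⊆ Ω := union_subset hm₁.image_subset hm₂.image_subset
  have hloc : LocallyLipschitzOn (γ₁ '' Icc 0 t ∪ γ₂ '' Icc 0 t) F := by
    intro x hx
    obtain ⟨K, s, hs, hL⟩ :=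
      (hF.contDiffAt (hΩ.mem_nhds (hKΩ hx))).exists_lipschitzOnWith
    exact ⟨K, s, mem_nhdsWithin_of_mem_nhds hs, hL⟩
  obtain ⟨K, hL⟩ := hloc.exists_lipschitzOnWith_of_compact hK
  have hd : ∀ {γ : ℝ → E}, IsIntegralCurveOn γ (fun _ => F) (Icc 0 t) →
      ∀ s ∈ Ico 0 t, HasDerivWithinAt γ (F (γ s)) (Ici s) s := fun h s hs =>
    (h s (Ico_subset_Icc_self hs)).mono_of_mem_nhdsWithin
      (Filter.mem_of_superset (Icc_mem_nhdsGE hs.2) (Icc_subset_Icc_left hs.1))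
  exact ODE_solution_unique_of_mem_Icc_right (v := fun _ => F)
    (s := fun _ => γ₁ '' Icc 0 t ∪ γ₂ '' Icc 0 t) (fun _ _ => hL) hc₁ (hd hi₁)
    (fun s hs => Or.inl (mem_image_of_mem _ (Ico_subset_Icc_self hs))) hc₂ (hd hi₂)
    (fun s hs => Or.inr (mem_image_of_mem _ (Ico_subset_Icc_self hs)))
    (h₁.initial.trans h₂.initial.symm) (right_mem_Icc.2 ht)

/-- The local flow of a `C¹` system is well defined: it is the value at time `t` of any solution
starting at `z`. -/
theorem localFlow_eq {F : E → E} {Ω : Set E} (hΩ : IsOpen Ω) (hF : ContDiffOn ℝ 1 F Ω)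
    {z : E} {t : ℝ} {γ : ℝ → E} (h : IsSolutionFrom F Ω z t γ) : localFlow F Ω t z = γ t := by
  have hex : ∃ γ : ℝ → E, IsSolutionFrom F Ω z t γ := ⟨γ, h⟩
  rw [localFlow, dif_pos hex]
  exact hex.choose_spec.eq hΩ hF h

/-- A `C¹` involution of `Ω` (hence a `C¹` diffeomorphism of `Ω` onto itself). -/
structure IsC1Involution (σ : E → E) (Ω : Set E) : Prop where
  contDiffOn : ContDiffOn ℝ 1 σ Ω
  mapsTo : MapsTo σ Ω Ω
  involutive : ∀ z ∈ Ω, σ (σ z) = z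

/-- The involution `σ` is a reversibility of `ż = F z` in `Ω`: `φ(t, σ z) = σ (φ(-t, z))` whenever
both sides are defined. -/
structure IsReversibility (σ F : E → E) (Ω : Set E) : Prop extends IsC1Involution σ Ω where
  reverses : ∀ t : ℝ, ∀ z ∈ Ω, (t, σ z) ∈ flowDomain F Ω → (-t, z) ∈ flowDomain F Ω →
    localFlow F Ω t (σ z) = σ (localFlow F Ω (-t) z)

/-- The arc of orbit of `z` between the times `0` and `t`. -/
def orbitArc (F : E → E) (Ω : Set E) (t : ℝ) (z : E) : Set E :=
  (fun s => localFlow F Ω s z) '' uIcc 0 t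

end Flow

section Euclidean

variable {n : ℕ}

/-- `σ` preserves the Lebesgue measure of the measurable subsets of `Ω`. -/
def IsMeasurePreservingOn (σ : EuclideanSpace ℝ (Fin n) → EuclideanSpace ℝ (Fin n))
    (Ω : Set (EuclideanSpace ℝ (Fin n))) : Prop :=
  ∀ A ⊆ Ω, MeasurableSet A → volume (σ '' A) = volume A

/-- The divergence `∑ i, ∂F_i/∂z_i`. -/
noncomputable def divergence (F : EuclideanSpace ℝ (Fin n) → EuclideanSpace ℝ (Fin n))
    (z : EuclideanSpace ℝ (Fin n)) : ℝ :=
  ∑ i, fderiv ℝ F z (EuclideanSpace.single i 1) i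

/-- The set of the points of `Ω` where the divergence of `F` vanishes. -/
def zeroDivergenceSet (F : EuclideanSpace ℝ (Fin n) → EuclideanSpace ℝ (Fin n))
    (Ω : Set (EuclideanSpace ℝ (Fin n))) : Set (EuclideanSpace ℝ (Fin n)) :=
  {z ∈ Ω | divergence F z = 0}

end Euclidean

/-! A reversibility `σ` conjugates `F` to `-F`, and the divergence of a vector field is invariant
under measure-preserving changes of variables, so `div F (σ z) = -div F z`. Part (i) is then the
intermediate value theorem along the arc of orbit, and in part (ii) the divergence equals its own
opposite.

Differentiating `Dσ F = -F ∘ σ` would give the invariance for `C²` maps, but `σ` is only `C¹`. The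
identity is therefore tested against smooth compactly supported functions: after integration by
parts only first derivatives of `σ` are left. -/

open Filter
open scoped Topology ContDiff

section LocalFlow

variable {E : Type*} [NormedAddCommGroup E] [NormedSpace ℝ E] {F : E → E} {Ω : Set E} {z : E}
  {t : ℝ} {γ : ℝ → E}

lemma IsSolutionFrom.mono {s : ℝ} (h : IsSolutionFrom F Ω z t γ) (hs : s ∈ uIcc 0 t) :
    IsSolutionFrom F Ω z s γ :=
  have hsub : uIcc 0 s ⊆ uIcc 0 t := uIcc_subset_uIcc left_mem_uIcc hs
  ⟨h.initial, h.mapsTo.mono_left hsub, h.isIntegralCurveOn.mono hsub⟩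

lemma IsSolutionFrom.localFlow_eqOn (hΩ : IsOpen Ω) (hF : ContDiffOn ℝ 1 F Ω)
    (h : IsSolutionFrom F Ω z t γ) : EqOn (fun s => localFlow F Ω s z) γ (uIcc 0 t) :=
  fun _ hs => localFlow_eq hΩ hF (h.mono hs)

lemma IsSolutionFrom.orbitArc_eq (hΩ : IsOpen Ω) (hF : ContDiffOn ℝ 1 F Ω)
    (h : IsSolutionFrom F Ω z t γ) : orbitArc F Ω t z = γ '' uIcc 0 t :=
  (h.localFlow_eqOn hΩ hF).image_eq

lemma orbitArc_subset (hΩ : IsOpen Ω) (hF : ContDiffOn ℝ 1 F Ω) (ht : (t, z) ∈ flowDomain F Ω) :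
    orbitArc F Ω t z ⊆ Ω := by
  obtain ⟨γ, hγ⟩ := ht
  exact hγ.orbitArc_eq hΩ hF ▸ hγ.mapsTo.image_subset

lemma isPreconnected_orbitArc (hΩ : IsOpen Ω) (hF : ContDiffOn ℝ 1 F Ω)
    (ht : (t, z) ∈ flowDomain F Ω) : IsPreconnected (orbitArc F Ω t z) := by
  obtain ⟨γ, hγ⟩ := ht
  rw [hγ.orbitArc_eq hΩ hF]
  exact isPreconnected_uIcc.image γ hγ.isIntegralCurveOn.continuousOn

lemma mem_orbitArc_self (hΩ : IsOpen Ω) (hF : ContDiffOn ℝ 1 F Ω)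
    (ht : (t, z) ∈ flowDomain F Ω) : z ∈ orbitArc F Ω t z := by
  obtain ⟨γ, hγ⟩ := ht
  exact ⟨0, left_mem_uIcc, (hγ.localFlow_eqOn hΩ hF left_mem_uIcc).trans hγ.initial⟩

lemma localFlow_mem_orbitArc : localFlow F Ω t z ∈ orbitArc F Ω t z :=
  mem_image_of_mem _ right_mem_uIcc

lemma exists_hasDerivAt_eventually_isSolutionFrom [CompleteSpace E] (hΩ : IsOpen Ω)
    (hF : ContDiffOn ℝ 1 F Ω) (hz : z ∈ Ω) :
    ∃ γ : ℝ → E, HasDerivAt γ (F z) 0 ∧ ∀ᶠ t in 𝓝 (0 : ℝ), IsSolutionFrom F Ω z t γ := by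
  obtain ⟨γ, hγ₀, ε, hε, hγ⟩ := (hF.contDiffAt (hΩ.mem_nhds hz)
    ).exists_forall_mem_closedBall_exists_eq_forall_mem_Ioo_hasDerivAt₀ 0
  have hderiv : HasDerivAt γ (F z) 0 := hγ₀ ▸ hγ 0 (by constructor <;> linarith)
  have hmem : ∀ᶠ t in 𝓝 (0 : ℝ), γ t ∈ Ω :=
    hderiv.continuousAt.eventually (by rw [hγ₀]; exact hΩ.mem_nhds hz)
  obtain ⟨δ, hδ, hball⟩ := Metric.eventually_nhds_iff_ball.1
    (hmem.and (Ioo_mem_nhds (show 0 - ε < 0 by linarith) (show 0 < 0 + ε by linarith)))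
  refine ⟨γ, hderiv, ?_⟩
  filter_upwards [Metric.ball_mem_nhds (0 : ℝ) hδ] with t ht
  have hsub : uIcc 0 t ⊆ Metric.ball 0 δ :=
    (convex_ball (0 : ℝ) δ).ordConnected.uIcc_subset (Metric.mem_ball_self hδ) ht
  exact ⟨hγ₀, fun s hs => (hball s (hsub hs)).1,
    fun s hs => (hγ s (hball s (hsub hs)).2).hasDerivWithinAt⟩

lemma eventually_mem_flowDomain [CompleteSpace E] (hΩ : IsOpen Ω) (hF : ContDiffOn ℝ 1 F Ω)
    (hz : z ∈ Ω) : ∀ᶠ t in 𝓝 (0 : ℝ), (t, z) ∈ flowDomain F Ω := by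
  obtain ⟨γ, -, hγ⟩ := exists_hasDerivAt_eventually_isSolutionFrom hΩ hF hz
  exact hγ.mono fun t ht => ⟨γ, ht⟩

lemma hasDerivAt_localFlow_zero [CompleteSpace E] (hΩ : IsOpen Ω) (hF : ContDiffOn ℝ 1 F Ω)
    (hz : z ∈ Ω) : HasDerivAt (fun t => localFlow F Ω t z) (F z) 0 := by
  obtain ⟨γ, hderiv, hγ⟩ := exists_hasDerivAt_eventually_isSolutionFrom hΩ hF hz
  exact hderiv.congr_of_eventuallyEq (hγ.mono fun t ht => localFlow_eq hΩ hF ht)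

lemma localFlow_zero (hΩ : IsOpen Ω) (hF : ContDiffOn ℝ 1 F Ω) (hz : z ∈ Ω) :
    localFlow F Ω 0 z = z := by
  refine localFlow_eq hΩ hF (γ := fun _ => z) ⟨rfl, fun _ _ => hz, ?_⟩
  rw [uIcc_self]
  exact fun _ _ => HasFDerivWithinAt.of_subsingleton subsingleton_singleton

lemma IsReversibility.fderiv_apply [CompleteSpace E] {σ : E → E} (hσ : IsReversibility σ F Ω)
    (hΩ : IsOpen Ω) (hF : ContDiffOn ℝ 1 F Ω) (hz : z ∈ Ω) :
    fderiv ℝ σ z (F z) = -F (σ z) := by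
  have hneg : Tendsto (fun t : ℝ => -t) (𝓝 0) (𝓝 0) := by
    simpa using (continuous_neg (G := ℝ)).tendsto 0
  have hreverses : (fun t => localFlow F Ω t (σ z)) =ᶠ[𝓝 0]
      fun t => σ (localFlow F Ω (-t) z) := by
    filter_upwards [eventually_mem_flowDomain hΩ hF (hσ.mapsTo hz),
      hneg.eventually (eventually_mem_flowDomain hΩ hF hz)] with t using hσ.reverses t z hz
  have hbackward : HasDerivAt (fun t => localFlow F Ω (-t) z) (-F z) 0 := by
    have h := hasDerivAt_localFlow_zero hΩ hF hz
    rw [← neg_zero] at h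
    simpa [Function.comp_def] using h.scomp 0 (hasDerivAt_neg (0 : ℝ))
  have hσz : HasFDerivAt σ (fderiv ℝ σ z) (localFlow F Ω (-0) z) := by
    rw [neg_zero, localFlow_zero hΩ hF hz]
    exact ((hσ.contDiffOn.contDiffAt (hΩ.mem_nhds hz)).differentiableAt one_ne_zero).hasFDerivAt
  have hderiv := ((hσz.comp_hasDerivAt 0 hbackward).congr_of_eventuallyEq hreverses).unique
    (hasDerivAt_localFlow_zero hΩ hF (hσ.mapsTo hz))
  rw [← hderiv, map_neg, neg_neg]

end LocalFlow

section ChangeOfVariables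

variable {X Y : Type*} [TopologicalSpace X] [TopologicalSpace Y] {e : OpenPartialHomeomorph X Y}

lemma tsupport_indicator_comp_subset [T2Space X] {M : Type*} [Zero M] {g : Y → M}
    (hgc : HasCompactSupport g) (hge : tsupport g ⊆ e.target) :
    tsupport (e.source.indicator (g ∘ e)) ⊆ e.symm '' tsupport g := by
  have hcompact := hgc.isCompact.image_of_continuousOn (e.continuousOn_symm.mono hge)
  refine closure_minimal (fun z hz => ?_) hcompact.isClosed
  have hze : z ∈ e.source := mem_of_indicator_ne_zero hz
  rw [Function.mem_support, indicator_of_mem hze] at hz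
  exact ⟨e z, subset_tsupport g hz, e.left_inv hze⟩

lemma tsupport_indicator_comp_subset_source [T2Space X] {M : Type*} [Zero M] {g : Y → M}
    (hgc : HasCompactSupport g) (hge : tsupport g ⊆ e.target) :
    tsupport (e.source.indicator (g ∘ e)) ⊆ e.source :=
  (tsupport_indicator_comp_subset hgc hge).trans (e.mapsTo_symm.mono_left hge).image_subset

lemma hasCompactSupport_indicator_comp [T2Space X] {M : Type*} [Zero M] {g : Y → M}
    (hgc : HasCompactSupport g) (hge : tsupport g ⊆ e.target) :
    HasCompactSupport (e.source.indicator (g ∘ e)) :=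
  (hgc.isCompact.image_of_continuousOn (e.continuousOn_symm.mono hge)).of_isClosed_subset
    (isClosed_tsupport _) (tsupport_indicator_comp_subset hgc hge)

variable [MeasurableSpace X] [OpensMeasurableSpace X] [MeasurableSpace Y] [BorelSpace Y]
  {μ : Measure X} {ν : Measure Y}

lemma map_restrict_source_eq_restrict_target
    (he : ∀ A ⊆ e.source, MeasurableSet A → ν (e '' A) = μ A) :
    (μ.restrict e.source).map e = ν.restrict e.target := by
  have hsource : MeasurableSet e.source := e.open_source.measurableSet
  ext s hs
  have hpre : MeasurableSet (e.source ∩ e ⁻¹' s) := by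
    have h := hsource.subtype_image (e.continuousOn.domRestrict.measurable hs)
    rwa [domRestrict_eq, preimage_comp, Subtype.image_preimage_coe] at h
  rw [Measure.map_apply_of_aemeasurable (e.continuousOn.aemeasurable hsource) hs,
    Measure.restrict_apply' hsource, Measure.restrict_apply hs, inter_comm,
    ← he _ inter_subset_left hpre, e.image_source_inter_eq', e.target_inter_inv_preimage_preimage,
    inter_comm]

lemma setIntegral_target_eq_setIntegral_source {V : Type*} [NormedAddCommGroup V] [NormedSpace ℝ V]
    (he : (μ.restrict e.source).map e = ν.restrict e.target) {f : Y → V}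
    (hf : AEStronglyMeasurable f (ν.restrict e.target)) :
    ∫ z in e.target, f z ∂ν = ∫ z in e.source, f (e z) ∂μ := by
  rw [← he] at hf ⊢
  exact integral_map (e.continuousOn.aemeasurable e.open_source.measurableSet) hf

end ChangeOfVariables

section TestFunctions

variable {X : Type*} [TopologicalSpace X] [MeasurableSpace X] {μ : Measure X} {Ω : Set X}
  {f g : X → ℝ}

lemma setIntegral_mul_eq_integral_of_tsupport_subset (hgΩ : tsupport g ⊆ Ω) :
    ∫ z in Ω, f z * g z ∂μ = ∫ z, f z * g z ∂μ :=
  setIntegral_eq_integral_of_forall_compl_eq_zero fun z hz => by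
    rw [image_eq_zero_of_notMem_tsupport fun h => hz (hgΩ h), mul_zero]

lemma integrable_mul_of_tsupport_subset [T2Space X] [OpensMeasurableSpace X]
    [IsFiniteMeasureOnCompacts μ] (hf : ContinuousOn f Ω) (hg : Continuous g)
    (hgc : HasCompactSupport g) (hgΩ : tsupport g ⊆ Ω) : Integrable (fun z => f z * g z) μ := by
  have hsupp : Function.support (fun z => f z * g z) ⊆ tsupport g := fun z hz =>
    subset_tsupport g (right_ne_zero_of_mul hz)
  rw [← integrableOn_iff_integrable_of_support_subset hsupp]
  exact ((hf.mono hgΩ).mul hg.continuousOn).integrableOn_compact' hgc.isCompact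
    hgc.isCompact.measurableSet

end TestFunctions

section WeakDerivative

variable {E : Type*} [NormedAddCommGroup E] [NormedSpace ℝ E]

lemma contDiff_indicator_comp {E' V : Type*} [NormedAddCommGroup E'] [NormedSpace ℝ E']
    [NormedAddCommGroup V] [NormedSpace ℝ V] {e : OpenPartialHomeomorph E E'} {k : ℕ∞ω}
    (he : ContDiffOn ℝ k e e.source) {g : E' → V} (hg : ContDiff ℝ k g)
    (hgc : HasCompactSupport g) (hge : tsupport g ⊆ e.target) :
    ContDiff ℝ k (e.source.indicator (g ∘ e)) := by
  refine contDiff_iff_contDiffAt.2 fun z => ?_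
  by_cases hz : z ∈ tsupport (e.source.indicator (g ∘ e))
  · have hsource : e.source ∈ 𝓝 z :=
      e.open_source.mem_nhds (tsupport_indicator_comp_subset_source hgc hge hz)
    exact (hg.contDiffAt.comp z (he.contDiffAt hsource)).congr_of_eventuallyEq
      (eventuallyEq_of_mem hsource fun _ => (indicator_of_mem · _))
  · exact contDiffAt_const.congr_of_eventuallyEq (notMem_tsupport_iff_eventuallyEq.1 hz)

variable [FiniteDimensional ℝ E] [MeasurableSpace E] [BorelSpace E] {μ : Measure E}
  [μ.IsAddHaarMeasure] {Ω : Set E} {f g : E → ℝ}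

lemma eqOn_of_setIntegral_mul_contDiff_eq (hΩ : IsOpen Ω) {f₁ f₂ : E → ℝ}
    (hf₁ : ContinuousOn f₁ Ω) (hf₂ : ContinuousOn f₂ Ω)
    (h : ∀ g : E → ℝ, ContDiff ℝ ∞ g → HasCompactSupport g → tsupport g ⊆ Ω →
      ∫ z in Ω, f₁ z * g z ∂μ = ∫ z in Ω, f₂ z * g z ∂μ) : EqOn f₁ f₂ Ω := by
  have hae : ∀ᵐ z ∂μ, z ∈ Ω → f₁ z - f₂ z = 0 := by
    refine hΩ.ae_eq_zero_of_integral_contDiff_smul_eq_zero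
      ((hf₁.sub hf₂).locallyIntegrableOn hΩ.measurableSet) fun g hg hgc hgΩ => ?_
    have heq := h g hg hgc hgΩ
    simp only [setIntegral_mul_eq_integral_of_tsupport_subset hgΩ] at heq
    simp only [smul_eq_mul, mul_comm (g _), sub_mul]
    rw [integral_sub (integrable_mul_of_tsupport_subset hf₁ hg.continuous hgc hgΩ)
      (integrable_mul_of_tsupport_subset hf₂ hg.continuous hgc hgΩ), heq, sub_self]
  refine Measure.eqOn_open_of_ae_eq (μ := μ) ?_ hΩ hf₁ hf₂
  filter_upwards [(ae_restrict_iff' hΩ.measurableSet).2 hae] with z using sub_eq_zero.1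

lemma setIntegral_fderiv_mul_eq_neg (hΩ : IsOpen Ω) (hf : ContDiffOn ℝ 1 f Ω)
    (hg : ContDiff ℝ 1 g) (hgc : HasCompactSupport g) (hgΩ : tsupport g ⊆ Ω) (v : E) :
    ∫ z in Ω, fderiv ℝ f z v * g z ∂μ = -∫ z in Ω, f z * fderiv ℝ g z v ∂μ := by
  have hf' : ContinuousOn (fun z => fderiv ℝ f z v) Ω :=
    (hf.continuousOn_fderiv_of_isOpen hΩ le_rfl).clm_apply continuousOn_const
  have hg' : Continuous fun z => fderiv ℝ g z v :=
    (hg.continuous_fderiv one_ne_zero).clm_apply continuous_const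
  have hg'Ω : tsupport (fun z => fderiv ℝ g z v) ⊆ Ω :=
    (tsupport_fderiv_apply_subset ℝ v).trans hgΩ
  have hint := integrable_mul_of_tsupport_subset (μ := μ) hf' hg.continuous hgc hgΩ
  have hint' := integrable_mul_of_tsupport_subset (μ := μ) hf.continuousOn hg'
    (hgc.fderiv_apply (𝕜 := ℝ) v) hg'Ω
  have hint₀ := integrable_mul_of_tsupport_subset (μ := μ) hf.continuousOn hg.continuous hgc hgΩ
  rw [setIntegral_mul_eq_integral_of_tsupport_subset hgΩ,
    setIntegral_mul_eq_integral_of_tsupport_subset hg'Ω]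
  simp only [mul_comm _ (g _), mul_comm _ (fderiv ℝ g _ v)] at hint hint' hint₀ ⊢
  exact integral_mul_fderiv_eq_neg_fderiv_mul_of_integrable hint' hint hint₀
    (fun z _ => hg.differentiable one_ne_zero z)
    (fun z hz => (hf.contDiffAt (hΩ.mem_nhds (hgΩ hz))).differentiableAt one_ne_zero)

end WeakDerivative

section TraceDivergence

variable {E : Type*} [NormedAddCommGroup E] [NormedSpace ℝ E]

/-- The divergence of a vector field on a finite-dimensional normed space, defined as the trace of
the derivative so that no coordinates have to be chosen. -/
noncomputable def traceDivergence (F : E → E) (z : E) : ℝ :=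
  LinearMap.trace ℝ E (fderiv ℝ F z)

lemma divergence_eq_traceDivergence {n : ℕ}
    (F : EuclideanSpace ℝ (Fin n) → EuclideanSpace ℝ (Fin n)) :
    divergence F = traceDivergence F := by
  ext z
  simp [divergence, traceDivergence,
    LinearMap.trace_eq_sum_inner _ (EuclideanSpace.basisFun (Fin n) ℝ),
    EuclideanSpace.inner_single_left]

lemma traceDivergence_neg (F : E → E) (z : E) : traceDivergence (-F) z = -traceDivergence F z := by
  simp [traceDivergence, fderiv_neg]

variable [FiniteDimensional ℝ E] {F : E → E} {Ω : Set E}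

lemma continuousOn_traceDivergence (hF : ContDiffOn ℝ 1 F Ω) (hΩ : IsOpen Ω) :
    ContinuousOn (traceDivergence F) Ω :=
  (LinearMap.continuous_of_finiteDimensional
    (LinearMap.trace ℝ E ∘ₗ ContinuousLinearMap.coeLM ℝ)).comp_continuousOn
      (hF.continuousOn_fderiv_of_isOpen hΩ le_rfl)

lemma traceDivergence_eq_sum_fderiv_coord {ι : Type*} [Fintype ι] (b : Module.Basis ι ℝ E) {z : E}
    (hF : DifferentiableAt ℝ F z) :
    traceDivergence F z = ∑ i, fderiv ℝ (fun w => b.coord i (F w)) z (b i) := by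
  classical
  have hcoord (i : ι) : fderiv ℝ (fun w => b.coord i (F w)) z
      = (b.coord i).toContinuousLinearMap ∘L fderiv ℝ F z :=
    ((b.coord i).toContinuousLinearMap.hasFDerivAt.comp z hF.hasFDerivAt).fderiv
  simp_rw [hcoord]
  simp [traceDivergence, LinearMap.trace_eq_matrix_trace ℝ b, Matrix.trace,
    LinearMap.toMatrix_apply]

lemma contDiffOn_coord_comp {ι : Type*} (b : Module.Basis ι ℝ E) {k : ℕ∞ω}
    (hF : ContDiffOn ℝ k F Ω) (i : ι) : ContDiffOn ℝ k (fun z => b.coord i (F z)) Ω :=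
  (b.coord i).toContinuousLinearMap.contDiff.comp_contDiffOn hF

variable [MeasurableSpace E] [BorelSpace E] {μ : Measure E} [μ.IsAddHaarMeasure]

lemma setIntegral_traceDivergence_mul (hΩ : IsOpen Ω) (hF : ContDiffOn ℝ 1 F Ω) {g : E → ℝ}
    (hg : ContDiff ℝ 1 g) (hgc : HasCompactSupport g) (hgΩ : tsupport g ⊆ Ω) :
    ∫ z in Ω, traceDivergence F z * g z ∂μ = -∫ z in Ω, fderiv ℝ g z (F z) ∂μ := by
  let b := Module.finBasis ℝ E
  let f := fun i z => b.coord i (F z)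
  have hf (i) : ContDiffOn ℝ 1 (f i) Ω := contDiffOn_coord_comp b hF i
  have hdiv : ∀ z ∈ Ω, traceDivergence F z * g z = ∑ i, fderiv ℝ (f i) z (b i) * g z :=
    fun z hz => by
      rw [traceDivergence_eq_sum_fderiv_coord b
        ((hF.contDiffAt (hΩ.mem_nhds hz)).differentiableAt one_ne_zero), Finset.sum_mul]
  have hgrad (z) : fderiv ℝ g z (F z) = ∑ i, f i z * fderiv ℝ g z (b i) := by
    conv_lhs => rw [← b.sum_repr (F z), map_sum]
    simp only [map_smul, smul_eq_mul, f, Module.Basis.coord_apply]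
  have hint (i) : Integrable (fun z => fderiv ℝ (f i) z (b i) * g z) (μ.restrict Ω) :=
    (integrable_mul_of_tsupport_subset (((hf i).continuousOn_fderiv_of_isOpen hΩ le_rfl).clm_apply
      continuousOn_const) hg.continuous hgc hgΩ).restrict
  have hint' (i) : Integrable (fun z => f i z * fderiv ℝ g z (b i)) (μ.restrict Ω) :=
    (integrable_mul_of_tsupport_subset (hf i).continuousOn
      ((hg.continuous_fderiv one_ne_zero).clm_apply continuous_const)
      (hgc.fderiv_apply (𝕜 := ℝ) _) ((tsupport_fderiv_apply_subset ℝ _).trans hgΩ)).restrict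
  simp_rw [setIntegral_congr_fun hΩ.measurableSet hdiv, hgrad,
    integral_finsetSum _ fun i _ => hint i, integral_finsetSum _ fun i _ => hint' i,
    ← Finset.sum_neg_distrib, setIntegral_fderiv_mul_eq_neg hΩ (hf _) hg hgc hgΩ]

section Invariance

variable {E' : Type*} [NormedAddCommGroup E'] [NormedSpace ℝ E'] [FiniteDimensional ℝ E']
  [MeasurableSpace E'] [BorelSpace E'] {ν : Measure E'} [ν.IsAddHaarMeasure]
  {e : OpenPartialHomeomorph E E'} {G : E' → E'}

lemma setIntegral_traceDivergence_mul_of_related (he : ContDiffOn ℝ 1 e e.source)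
    (hmap : (μ.restrict e.source).map e = ν.restrict e.target)
    (hF : ContDiffOn ℝ 1 F e.source) (hG : ContDiffOn ℝ 1 G e.target)
    (hFG : ∀ z ∈ e.source, fderiv ℝ e z (F z) = G (e z)) {g : E' → ℝ} (hg : ContDiff ℝ 1 g)
    (hgc : HasCompactSupport g) (hge : tsupport g ⊆ e.target) :
    ∫ z in e.target, traceDivergence G z * g z ∂ν
      = ∫ z in e.source, traceDivergence F z * g (e z) ∂μ := by
  have hsource : MeasurableSet e.source := e.open_source.measurableSet
  let h := e.source.indicator (g ∘ e)
  have hh : EqOn h (g ∘ e) e.source := fun z hz => indicator_of_mem hz _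
  have hderiv : ∀ z ∈ e.source, fderiv ℝ g (e z) (G (e z)) = fderiv ℝ h z (F z) := by
    intro z hz
    have hznhds : e.source ∈ 𝓝 z := e.open_source.mem_nhds hz
    rw [(hh.eventuallyEq_of_mem hznhds).fderiv_eq, fderiv_comp z
      (hg.differentiable one_ne_zero _) ((he.contDiffAt hznhds).differentiableAt one_ne_zero),
      ContinuousLinearMap.comp_apply, hFG z hz]
  calc ∫ z in e.target, traceDivergence G z * g z ∂ν
      = -∫ z in e.target, fderiv ℝ g z (G z) ∂ν :=
        setIntegral_traceDivergence_mul e.open_target hG hg hgc hge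
    _ = -∫ z in e.source, fderiv ℝ g (e z) (G (e z)) ∂μ := by
        rw [setIntegral_target_eq_setIntegral_source hmap
          (((hg.continuous_fderiv one_ne_zero).continuousOn.clm_apply
            hG.continuousOn).aestronglyMeasurable e.open_target.measurableSet)]
    _ = -∫ z in e.source, fderiv ℝ h z (F z) ∂μ := by
        rw [setIntegral_congr_fun hsource hderiv]
    _ = ∫ z in e.source, traceDivergence F z * h z ∂μ :=
        (setIntegral_traceDivergence_mul e.open_source hF (contDiff_indicator_comp he hg hgc hge)
          (hasCompactSupport_indicator_comp hgc hge)
          (tsupport_indicator_comp_subset_source hgc hge)).symm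
    _ = ∫ z in e.source, traceDivergence F z * g (e z) ∂μ :=
        setIntegral_congr_fun hsource fun z hz => by simp only [hh hz, Function.comp_apply]

theorem traceDivergence_apply_of_related (he : ContDiffOn ℝ 1 e e.source)
    (hmap : (μ.restrict e.source).map e = ν.restrict e.target)
    (hF : ContDiffOn ℝ 1 F e.source) (hG : ContDiffOn ℝ 1 G e.target)
    (hFG : ∀ z ∈ e.source, fderiv ℝ e z (F z) = G (e z)) {z : E} (hz : z ∈ e.source) :
    traceDivergence G (e z) = traceDivergence F z := by
  have hdivF : ContinuousOn (traceDivergence F ∘ e.symm) e.target :=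
    (continuousOn_traceDivergence hF e.open_source).comp e.continuousOn_symm e.mapsTo_symm
  have heq : EqOn (traceDivergence G) (traceDivergence F ∘ e.symm) e.target := by
    refine eqOn_of_setIntegral_mul_contDiff_eq (μ := ν) e.open_target
      (continuousOn_traceDivergence hG e.open_target) hdivF fun g hg hgc hge => ?_
    rw [setIntegral_traceDivergence_mul_of_related he hmap hF hG hFG (hg.of_le (by simp)) hgc hge,
      setIntegral_target_eq_setIntegral_source hmap (f := fun w => _ * g w)
        ((hdivF.mul hg.continuous.continuousOn).aestronglyMeasurable e.open_target.measurableSet)]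
    exact setIntegral_congr_fun e.open_source.measurableSet fun w hw => by
      simp only [Function.comp_apply, e.left_inv hw]
  rw [heq (e.map_source hz), Function.comp_apply, e.left_inv hz]

end Invariance

end TraceDivergence

section Reversibility

variable {E : Type*} [NormedAddCommGroup E] [NormedSpace ℝ E] {σ F : E → E} {Ω : Set E}

/-- A `C¹` involution of an open set as a homeomorphism of this set onto itself, with inverse
`σ`. -/
def IsC1Involution.toOpenPartialHomeomorph (hσ : IsC1Involution σ Ω) (hΩ : IsOpen Ω) :
    OpenPartialHomeomorph E E where
  toFun := σ
  invFun := σ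
  source := Ω
  target := Ω
  map_source' := hσ.mapsTo
  map_target' := hσ.mapsTo
  left_inv' := hσ.involutive
  right_inv' := hσ.involutive
  open_source := hΩ
  open_target := hΩ
  continuousOn_toFun := hσ.contDiffOn.continuousOn
  continuousOn_invFun := hσ.contDiffOn.continuousOn

variable [FiniteDimensional ℝ E] [MeasurableSpace E] [BorelSpace E] {μ : Measure E}
  [μ.IsAddHaarMeasure]

theorem IsReversibility.traceDivergence_apply (hσ : IsReversibility σ F Ω) (hΩ : IsOpen Ω)
    (hF : ContDiffOn ℝ 1 F Ω) (hμ : ∀ A ⊆ Ω, MeasurableSet A → μ (σ '' A) = μ A) {z : E}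
    (hz : z ∈ Ω) : traceDivergence F (σ z) = -traceDivergence F z := by
  let e := hσ.toIsC1Involution.toOpenPartialHomeomorph hΩ
  have hrelated : traceDivergence (-F) (σ z) = traceDivergence F z :=
    traceDivergence_apply_of_related (e := e) hσ.contDiffOn
      (map_restrict_source_eq_restrict_target hμ) hF hF.neg
      (fun w hw => hσ.fderiv_apply hΩ hF hw) hz
  rw [← hrelated, traceDivergence_neg, neg_neg]

end Reversibility

theorem theorem1_general {E : Type*} [NormedAddCommGroup E] [NormedSpace ℝ E]
    [FiniteDimensional ℝ E] [MeasurableSpace E] [BorelSpace E] (μ : Measure E) [μ.IsAddHaarMeasure]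
    {Ω : Set E} (hΩ : IsOpen Ω) {F : E → E} (hF : ContDiffOn ℝ 1 F Ω) {σ : E → E}
    (hσ : IsReversibility σ F Ω) (hμ : ∀ A ⊆ Ω, MeasurableSet A → μ (σ '' A) = μ A) :
    (∀ z ∈ Ω, ∀ t : ℝ, (t, z) ∈ flowDomain F Ω → σ z = localFlow F Ω t z →
      ∃ z₀ ∈ orbitArc F Ω t z, z₀ ∈ Ω ∧ traceDivergence F z₀ = 0) ∧
    (∀ z ∈ Ω, σ z = z → traceDivergence F z = 0) := by
  have hdiv : ∀ z ∈ Ω, traceDivergence F (σ z) = -traceDivergence F z := fun z hz =>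
    hσ.traceDivergence_apply hΩ hF hμ hz
  refine ⟨fun z hz t ht hσz => ?_, fun z hz hfix => ?_⟩
  · have hsub : orbitArc F Ω t z ⊆ Ω := orbitArc_subset hΩ hF ht
    have hconn : IsPreconnected (traceDivergence F '' orbitArc F Ω t z) :=
      (isPreconnected_orbitArc hΩ hF ht).image _ ((continuousOn_traceDivergence hF hΩ).mono hsub)
    have hstart := mem_image_of_mem (traceDivergence F) (mem_orbitArc_self hΩ hF ht)
    have hend : -traceDivergence F z ∈ traceDivergence F '' orbitArc F Ω t z :=
      ⟨σ z, hσz ▸ localFlow_mem_orbitArc, hdiv z hz⟩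
    have hzero : (0 : ℝ) ∈ uIcc (traceDivergence F z) (-traceDivergence F z) := by
      simpa [mem_uIcc] using le_total _ _
    obtain ⟨z₀, hz₀, hdiv₀⟩ := hconn.ordConnected.uIcc_subset hstart hend hzero
    exact ⟨z₀, hz₀, hsub hz₀, hdiv₀⟩
  · have h := hdiv z hz
    rwa [hfix, self_eq_neg] at h

theorem theorem1 (n : ℕ) (Ω : Set (EuclideanSpace ℝ (Fin n))) (hΩ : IsOpen Ω)
    (hΩc : IsConnected Ω) (F : EuclideanSpace ℝ (Fin n) → EuclideanSpace ℝ (Fin n))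
    (hF : ContDiffOn ℝ 1 F Ω) (σ : EuclideanSpace ℝ (Fin n) → EuclideanSpace ℝ (Fin n))
    (hσ : IsReversibility σ F Ω) (hμ : IsMeasurePreservingOn σ Ω) :
    (∀ z ∈ Ω, ∀ t : ℝ, (t, z) ∈ flowDomain F Ω → σ z = localFlow F Ω t z → σ z ≠ z →
      ∃ z₀ ∈ orbitArc F Ω t z, z₀ ∈ zeroDivergenceSet F Ω) ∧
    (∀ z ∈ Ω, σ z = z → F z ≠ 0 → z ∈ zeroDivergenceSet F Ω) := by
  simp only [zeroDivergenceSet, divergence_eq_traceDivergence]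
  exact (theorem1_general volume hΩ hF hσ hμ).imp (fun harc z hz t ht hσz _ => harc z hz t ht hσz)
    fun hfix z hz hσz _ => ⟨hz, hfix z hz hσz⟩
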